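/- Let $(X,\mathcal B,\mu)$ be a standard non-atomic probability space. There exists $f\in L^1(\mu)$ with $\int_X f\,d\mu=0$ such that, for every invertible ergodic $\mu$-preserving transformation $T:X\to X$ and every integer $d\ge 1$, there exist integers $v_n=v_{n,d}$ (depending on $T$ and $d$) $(n\ge 1)$ such that for $\mu$-a.e. $x\in X$, $$\limsup_{n\to\infty}\frac1{n^d}\sum_{i=v_n+1}^{v_n+n^d} f(T^i x)>0 ,$$ and these averages fail to converge to a finite limit as $n\to\infty$. Here the limsup is taken in $[-\infty,\infty]$. -/

import Mathlib

open MeasureTheory Filter Topology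

/-- The moving average `(1 / L) * ∑_{i = v + 1}^{v + L} f (T ^ i x)` of `f` along the orbit of `x`
under the invertible map `T`; the powers `T ^ i`, `i : ℤ`, are taken in the group of
permutations of `X`. -/
noncomputable def movingAverage {X : Type*} [MeasurableSpace X] (T : X ≃ᵐ X) (f : X → ℝ)
    (v : ℤ) (L : ℕ) (x : X) : ℝ :=
  (1 / (L : ℝ)) * ∑ i ∈ Finset.Icc (v + 1) (v + (L : ℤ)), f ((T.toEquiv ^ i : Equiv.Perm X) x)

/-! Take `f = g - ∫ g`, where `g ≥ 0` has integral at most 1/4 and dominates a.e. very high peaks `M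
k` on sets `E k`, the k-th of mass about `2 ^ (-k)`. Let `B n` be the event that the average of `g`
over the first `n ^ d` iterates is at least 1/2.

The sum of the measures of the `B n` diverges for every measure preserving `T`. By the covering
inequality `mass_le_sum_windows`, mass carried by peaks of height `M` forces proportionally many
good windows, with a factor `r` gained by counting all lengths `n ^ d`, `n ≤ r * M`. A peak fills
long stretches of average at least 1, and a stretch of length `ℓ` contains of order `ℓ ^ (1 + 1 /
d)` good windows. With `r = 4 ^ k` this gain beats the decay of the masses.

Ergodicity then gives a converse Borel–Cantelli statement, `Ergodic.exists_frequently_mem`: suitable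
shifts put almost every orbit in infinitely many `B n`. To prevent convergence, indices of one
parity, along which the sum still diverges, serve the `B n`; the other parity serves low averages,
whose probability is bounded below by Markov. -/

/-! ### Combinatorial covering inequality. -/

/-- If all suffixes of length at most `ℓ` of the segment ending at `m` have average at least `1`,
then at least `L / 2` windows of length `L ≤ ℓ` starting in the last `ℓ` places
have average at least `1 / 2`. -/
lemma half_le_card_windows {a : ℕ → ℝ} (ha : ∀ i, 0 ≤ a i) {m ℓ L : ℕ} (hℓ : ℓ ≤ m)
    (hL : L ≤ ℓ) (hL0 : 1 ≤ L)
    (hsuf : ∀ j, 1 ≤ j → j ≤ ℓ → (j : ℝ) ≤ ∑ i ∈ Finset.Ico (m - j) m, a i) :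
    (L : ℝ) / 2 ≤ ∑ s ∈ Finset.Ico (m - ℓ) m,
      if (L : ℝ) / 2 ≤ ∑ i ∈ Finset.Ico s (s + L), a i then (1 : ℝ) else 0 := by
  -- A window starting here contains the suffix of length `⌈L / 2⌉`, whose mass is already at least
  -- `L / 2`.
  have hsub : Finset.Icc (m - L) (m - (L + 1) / 2) ⊆ (Finset.Ico (m - ℓ) m).filter
      (fun s => (L : ℝ) / 2 ≤ ∑ i ∈ Finset.Ico s (s + L), a i) := by
    intro s hs
    rw [Finset.mem_Icc] at hs
    rw [Finset.mem_filter, Finset.mem_Ico]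
    refine ⟨by omega, ?_⟩
    have h1 : (L : ℝ) / 2 ≤ (((L + 1) / 2 : ℕ) : ℝ) := by
      have : L ≤ 2 * ((L + 1) / 2) := by omega
      have : (L : ℝ) ≤ 2 * (((L + 1) / 2 : ℕ) : ℝ) := by exact_mod_cast this
      linarith
    refine h1.trans ((hsuf ((L + 1) / 2) (by omega) (by omega)).trans ?_)
    refine Finset.sum_le_sum_of_subset_of_nonneg ?_ fun i _ _ => ha i
    intro i hi
    rw [Finset.mem_Ico] at hi ⊢
    omega
  rw [Finset.sum_boole]
  have h2 := Finset.card_le_card hsub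
  rw [Nat.card_Icc] at h2
  have h3 : L ≤ 2 * (m - (L + 1) / 2 + 1 - (m - L)) := by omega
  have h4 : (L : ℝ) ≤ 2 * ((m - (L + 1) / 2 + 1 - (m - L) : ℕ) : ℝ) := by exact_mod_cast h3
  have h5 := (Nat.cast_le (α := ℝ)).2 h2
  linarith

/-- The sum of the `d`-th powers up to `ℓ` is at least of order `ℓ ^ (1 + 1 / d)`. -/
lemma mul_le_sum_pow {d q ℓ N : ℕ} (hq : 1 ≤ q) (hqN : q ≤ N) (hqℓ : q ^ d ≤ ℓ)
    (hN : ℓ ≤ N ^ d) :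
    (q : ℝ) * ℓ / 2 ^ (d + 2) ≤
      ∑ n ∈ (Finset.Icc 1 N).filter (fun n => n ^ d ≤ ℓ), ((n ^ d : ℕ) : ℝ) / 2 := by
  classical
  -- `p` is the largest number up to `N` with `p ^ d ≤ ℓ`
  obtain ⟨p, hqp, hpN, hpℓ, hp⟩ : ∃ p, q ≤ p ∧ p ≤ N ∧ p ^ d ≤ ℓ ∧ ℓ ≤ (p + 1) ^ d := by
    let P := fun p => p ^ d ≤ ℓ
    have h1 : P (Nat.findGreatest P N) := Nat.findGreatest_spec hqN hqℓ
    refine ⟨Nat.findGreatest P N, Nat.le_findGreatest hqN hqℓ, Nat.findGreatest_le N, h1, ?_⟩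
    rcases (Nat.findGreatest_le (P := P) N).lt_or_eq with h | h
    · have := Nat.findGreatest_is_greatest (P := P) (Nat.lt_succ_self _) h
      exact (not_le.1 this).le
    · rw [h]
      exact hN.trans (Nat.pow_le_pow_left (Nat.le_succ N) d)
  -- Every `n` in this upper half satisfies `2 * n ≥ p + 1`, hence `n ^ d ≥ ℓ / 2 ^ d`.
  have hsub : Finset.Icc (p - (p - 1) / 2) p ⊆
      (Finset.Icc 1 N).filter (fun n => n ^ d ≤ ℓ) := by
    intro n hn
    rw [Finset.mem_Icc] at hn
    rw [Finset.mem_filter, Finset.mem_Icc]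
    exact ⟨by omega, (Nat.pow_le_pow_left hn.2 d).trans hpℓ⟩
  have hterm : ∀ n ∈ Finset.Icc (p - (p - 1) / 2) p,
      (ℓ : ℝ) / 2 ^ (d + 1) ≤ ((n ^ d : ℕ) : ℝ) / 2 := by
    intro n hn
    rw [Finset.mem_Icc] at hn
    have h1 : ℓ ≤ (2 * n) ^ d := hp.trans (Nat.pow_le_pow_left (by omega) d)
    have h2 : (ℓ : ℝ) ≤ 2 ^ d * (n : ℝ) ^ d := by rw [← mul_pow]; exact_mod_cast h1
    push_cast
    rw [div_le_div_iff₀ (by positivity) (by norm_num), pow_succ]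
    nlinarith
  have hcard : (q : ℝ) / 2 ≤ ((Finset.Icc (p - (p - 1) / 2) p).card : ℝ) := by
    rw [Nat.card_Icc]
    have : q ≤ 2 * (p + 1 - (p - (p - 1) / 2)) := by omega
    have : (q : ℝ) ≤ 2 * ((p + 1 - (p - (p - 1) / 2) : ℕ) : ℝ) := by exact_mod_cast this
    linarith
  calc (q : ℝ) * ℓ / 2 ^ (d + 2) = (q : ℝ) / 2 * (ℓ / 2 ^ (d + 1)) := by
        rw [pow_succ]; field_simp
    _ ≤ ((Finset.Icc (p - (p - 1) / 2) p).card : ℝ) * (ℓ / 2 ^ (d + 1)) := by gcongr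
    _ ≤ ∑ n ∈ Finset.Icc (p - (p - 1) / 2) p, ((n ^ d : ℕ) : ℝ) / 2 := by
        rw [← nsmul_eq_mul]
        exact Finset.card_nsmul_le_sum _ _ _ hterm
    _ ≤ _ := Finset.sum_le_sum_of_subset_of_nonneg hsub fun i _ _ => by positivity

/-- A covering inequality: the mass of a sequence with values in `{0, M}` is controlled by the
number of windows of length `n ^ d`, `n ≤ r * M`, with average at least `1 / 2`. -/
lemma mass_le_sum_windows {a : ℕ → ℝ} {M r d : ℕ} (hr : 1 ≤ r) (hd : 1 ≤ d)
    (hM : 2 * r ^ d ≤ M) (ha : ∀ i, a i = 0 ∨ a i = M) (m : ℕ) :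
    (r : ℝ) / 2 ^ (d + 3) * ∑ i ∈ Finset.Ico ((r * M) ^ d) m, a i ≤
      ∑ s ∈ Finset.range m, ∑ n ∈ Finset.Icc 1 (r * M),
        if ((n ^ d : ℕ) : ℝ) / 2 ≤ ∑ i ∈ Finset.Ico s (s + n ^ d), a i then (1 : ℝ) else 0 := by
  have hrd : 1 ≤ r ^ d := Nat.one_le_pow _ _ hr
  have ha0 : ∀ i, 0 ≤ a i := fun i => by rcases ha i with h | h <;> rw [h]; positivity
  have haM : ∀ i, a i ≤ M := fun i => by rcases ha i with h | h <;> rw [h]; positivity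
  set R := (r * M) ^ d with hR
  set W : ℕ → ℕ → ℝ := fun s n =>
    if ((n ^ d : ℕ) : ℝ) / 2 ≤ ∑ i ∈ Finset.Ico s (s + n ^ d), a i then (1 : ℝ) else 0 with hW
  have hW0 : ∀ s n, 0 ≤ W s n := fun s n => by simp only [hW]; split_ifs <;> norm_num
  have hrM : r ≤ r * M := Nat.le_mul_of_pos_right r (by omega)
  have hMR : M ≤ R := calc
    M ≤ r * M := Nat.le_mul_of_pos_left M hr
    _ ≤ R := Nat.le_self_pow (by omega) _
  change _ ≤ ∑ s ∈ Finset.range m, ∑ n ∈ Finset.Icc 1 (r * M), W s n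
  induction m using Nat.strong_induction_on with
  | _ m ih =>
  rcases le_or_gt m R with hmR | hmR
  · rw [Finset.Ico_eq_empty_of_le hmR, Finset.sum_empty, mul_zero]
    exact Finset.sum_nonneg fun s _ => Finset.sum_nonneg fun n _ => hW0 s n
  -- it is enough to find a final segment with the right inequality
  suffices h : ∃ ℓ, 1 ≤ ℓ ∧ ℓ ≤ m ∧ (r : ℝ) / 2 ^ (d + 3) * ∑ i ∈ Finset.Ico (m - ℓ) m, a i ≤
      ∑ s ∈ Finset.Ico (m - ℓ) m, ∑ n ∈ Finset.Icc 1 (r * M), W s n by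
    obtain ⟨ℓ, hℓ1, hℓm, hℓ⟩ := h
    have h1 := ih (m - ℓ) (by omega)
    have h2 : ∑ i ∈ Finset.Ico R m, a i ≤
        ∑ i ∈ Finset.Ico R (m - ℓ), a i + ∑ i ∈ Finset.Ico (m - ℓ) m, a i := by
      rw [← Finset.sum_union (Finset.disjoint_left.2 fun i hi hi' => by
        rw [Finset.mem_Ico] at hi hi'; omega)]
      refine Finset.sum_le_sum_of_subset_of_nonneg (fun i hi => ?_) fun i _ _ => ha0 i
      rw [Finset.mem_union, Finset.mem_Ico, Finset.mem_Ico]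
      rw [Finset.mem_Ico] at hi
      omega
    rw [← Finset.sum_range_add_sum_Ico _ (Nat.sub_le m ℓ)]
    calc _ ≤ (r : ℝ) / 2 ^ (d + 3) * (∑ i ∈ Finset.Ico R (m - ℓ), a i +
          ∑ i ∈ Finset.Ico (m - ℓ) m, a i) := by gcongr
      _ ≤ _ := by rw [mul_add]; exact add_le_add h1 hℓ
  have hcount : ∀ ℓ q : ℕ, ℓ ≤ m → ℓ ≤ R → 1 ≤ q → q ≤ r * M → q ^ d ≤ ℓ →
      (∀ j, 1 ≤ j → j ≤ ℓ → (j : ℝ) ≤ ∑ i ∈ Finset.Ico (m - j) m, a i) →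
      (q : ℝ) * ℓ / 2 ^ (d + 2) ≤
        ∑ s ∈ Finset.Ico (m - ℓ) m, ∑ n ∈ Finset.Icc 1 (r * M), W s n := by
    intro ℓ q hℓm hℓR hq hqN hqℓ hsuf
    refine (mul_le_sum_pow hq hqN hqℓ hℓR).trans ?_
    rw [Finset.sum_comm]
    calc _ ≤ ∑ n ∈ (Finset.Icc 1 (r * M)).filter (fun n => n ^ d ≤ ℓ),
          ∑ s ∈ Finset.Ico (m - ℓ) m, W s n := by
          refine Finset.sum_le_sum fun n hn => ?_
          rw [Finset.mem_filter, Finset.mem_Icc] at hn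
          exact half_le_card_windows ha0 hℓm hn.2 (Nat.one_le_pow _ _ hn.1.1) hsuf
      _ ≤ _ := Finset.sum_le_sum_of_subset_of_nonneg (Finset.filter_subset _ _)
          fun n _ _ => Finset.sum_nonneg fun s _ => hW0 s n
  rcases ha (m - 1) with h0 | h0
  · refine ⟨1, le_rfl, by omega, ?_⟩
    have : Finset.Ico (m - 1) m = {m - 1} := by ext i; simp; omega
    rw [this, Finset.sum_singleton, h0, mul_zero, Finset.sum_singleton]
    exact Finset.sum_nonneg fun n _ => hW0 _ n
  -- If all suffixes up to length `R` are dense, the crude bound `R * M` on the mass is matched by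
  -- `q = r * M`. Otherwise the stretch stops just before the first failing length, so its mass is
  -- at most `2 * ℓ`, and `q = r` suffices.
  by_cases hsufR : ∀ j, 1 ≤ j → j ≤ R → (j : ℝ) ≤ ∑ i ∈ Finset.Ico (m - j) m, a i
  · refine ⟨R, by omega, hmR.le, ?_⟩
    refine le_trans ?_ (hcount R (r * M) hmR.le le_rfl (by omega) le_rfl le_rfl hsufR)
    have h1 : ∑ i ∈ Finset.Ico (m - R) m, a i ≤ R * M := by
      refine (Finset.sum_le_card_nsmul _ _ _ fun i _ => haM i).trans ?_
      rw [Nat.card_Ico, nsmul_eq_mul, show m - (m - R) = R by omega]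
    calc (r : ℝ) / 2 ^ (d + 3) * ∑ i ∈ Finset.Ico (m - R) m, a i
        ≤ (r : ℝ) / 2 ^ (d + 3) * (R * M) := by gcongr
      _ ≤ (r : ℝ) / 2 ^ (d + 2) * (R * M) := by gcongr <;> norm_num
      _ = _ := by push_cast; ring
  · push Not at hsufR
    classical
    let hex : ∃ j, 1 ≤ j ∧ j ≤ R ∧ ∑ i ∈ Finset.Ico (m - j) m, a i < (j : ℝ) := hsufR
    obtain ⟨hτ1, hτR, hτ⟩ := Nat.find_spec hex
    have hmin : ∀ j, j < Nat.find hex → 1 ≤ j → (j : ℝ) ≤ ∑ i ∈ Finset.Ico (m - j) m, a i := by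
      intro j hj hj1
      by_contra hcon
      exact Nat.find_min hex hj ⟨hj1, by omega, not_le.1 hcon⟩
    set τ := Nat.find hex
    -- The single peak at `m - 1` keeps every suffix of length at most `M` dense.
    have hMτ : M < τ := by
      have : (M : ℝ) ≤ ∑ i ∈ Finset.Ico (m - τ) m, a i := by
        rw [← h0]
        exact Finset.single_le_sum (fun i _ => ha0 i) (Finset.mem_Ico.2 ⟨by omega, by omega⟩)
      exact_mod_cast this.trans_lt hτ
    obtain ⟨ℓ, hℓ⟩ : ∃ ℓ, τ = ℓ + 1 := ⟨τ - 1, by omega⟩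
    refine ⟨ℓ, by omega, by omega, ?_⟩
    refine le_trans ?_ (hcount ℓ r (by omega) (by omega) hr hrM (by omega)
      fun j hj1 hjℓ => hmin j (by omega) hj1)
    have h1 : ∑ i ∈ Finset.Ico (m - ℓ) m, a i ≤ 2 * ℓ := by
      have h2 : ∑ i ∈ Finset.Ico (m - ℓ) m, a i ≤ ∑ i ∈ Finset.Ico (m - τ) m, a i :=
        Finset.sum_le_sum_of_subset_of_nonneg
          (Finset.Ico_subset_Ico_left (by omega)) fun i _ _ => ha0 i
      have h3 : (τ : ℝ) ≤ 2 * ℓ := by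
        have : τ ≤ 2 * ℓ := by omega
        exact_mod_cast this
      linarith
    calc (r : ℝ) / 2 ^ (d + 3) * ∑ i ∈ Finset.Ico (m - ℓ) m, a i
        ≤ (r : ℝ) / 2 ^ (d + 3) * (2 * ℓ) := by gcongr
      _ = _ := by rw [pow_succ _ (d + 2)]; field_simp

/-! ### Integrated form of the covering inequality. -/

/-- The windowed averages of a multiple of an indicator function: a lower bound, uniform in the
measure preserving map, for the total measure of the points with average at least `1 / 2`. -/
lemma le_sum_measure_windows {X : Type*} [MeasurableSpace X] {μ : Measure X}
    [IsProbabilityMeasure μ] {T : X → X} (hT : MeasurePreserving T μ μ) {E : Set X}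
    (hE : MeasurableSet E) {M r d : ℕ} (hr : 1 ≤ r) (hd : 1 ≤ d) (hM : 2 * r ^ d ≤ M) :
    (r : ℝ) / 2 ^ (d + 4) * (M * μ.real E) ≤ ∑ n ∈ Finset.Icc 1 (r * M),
      μ.real {x | ((n ^ d : ℕ) : ℝ) / 2 ≤
        ∑ i ∈ Finset.range (n ^ d), E.indicator (fun _ => (M : ℝ)) (T^[i] x)} := by
  set h : X → ℝ := E.indicator (fun _ => (M : ℝ)) with hh
  have hhm : Measurable h := measurable_const.indicator hE
  set B : ℕ → Set X := fun n => {x | ((n ^ d : ℕ) : ℝ) / 2 ≤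
        ∑ i ∈ Finset.range (n ^ d), h (T^[i] x)} with hB
  have hBm : ∀ n, MeasurableSet (B n) := fun n => measurableSet_le measurable_const
    (Finset.measurable_sum _ fun i _ => hhm.comp (hT.measurable.iterate i))
  set R := (r * M) ^ d with hR
  have hR0 : 0 < R := Nat.pow_pos (Nat.mul_pos hr
    (lt_of_lt_of_le (by have := Nat.one_le_pow d r hr; omega) hM))
  -- With `m = 2 * R` there are `R` places of mass against `2 * R` starting points, which costs one
  -- factor 2.
  have key : ∀ x, (r : ℝ) / 2 ^ (d + 3) * ∑ i ∈ Finset.Ico R (2 * R), h (T^[i] x) ≤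
      ∑ s ∈ Finset.range (2 * R), ∑ n ∈ Finset.Icc 1 (r * M),
        (T^[s] ⁻¹' B n).indicator (fun _ => (1 : ℝ)) x := by
    intro x
    have := mass_le_sum_windows (a := fun i => h (T^[i] x)) hr hd hM (fun i => by
      simp only [hh, Set.indicator]; split_ifs <;> simp) (2 * R)
    refine this.trans (le_of_eq ?_)
    refine Finset.sum_congr rfl fun s _ => Finset.sum_congr rfl fun n _ => ?_
    rw [Finset.sum_Ico_eq_sum_range, Nat.add_sub_cancel_left]
    simp only [Set.indicator, Set.mem_preimage, hB, Set.mem_ofPred_eq,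
      ← Function.iterate_add_apply, add_comm s]
  have hint : ∀ i, Integrable (fun x => h (T^[i] x)) μ := fun i =>
    (hT.iterate i).integrable_comp_of_integrable ((integrable_const _).indicator hE)
  have hinth : ∀ i, ∫ x, h (T^[i] x) ∂μ = M * μ.real E := fun i => by
    rw [← integral_map (hT.iterate i).measurable.aemeasurable
      hhm.aestronglyMeasurable, (hT.iterate i).map_eq, hh, integral_indicator_const _ hE,
      smul_eq_mul, mul_comm]
  have hint2 : ∀ s n, Integrable ((T^[s] ⁻¹' B n).indicator (fun _ => (1 : ℝ))) μ := fun s n =>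
    (integrable_const _).indicator ((hT.iterate s).measurable (hBm n))
  have hint3 : ∀ s n, ∫ x, (T^[s] ⁻¹' B n).indicator (fun _ => (1 : ℝ)) x ∂μ = μ.real (B n) :=
    fun s n => by
      rw [integral_indicator_const _ ((hT.iterate s).measurable (hBm n)), smul_eq_mul, mul_one,
        measureReal_def, (hT.iterate s).measure_preimage (hBm n).nullMeasurableSet,
        measureReal_def]
  have := integral_mono (μ := μ)
    ((integrable_finsetSum _ fun i _ => hint i).const_mul _)
    (integrable_finsetSum _ fun s _ => integrable_finsetSum _ fun n _ => hint2 s n) key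
  rw [integral_const_mul, integral_finsetSum _ fun i _ => hint i,
    integral_finsetSum _ fun s _ => integrable_finsetSum _ fun n _ => hint2 s n] at this
  simp only [integral_finsetSum _ fun n _ => hint2 _ n, hinth, hint3, Finset.sum_const,
    Nat.card_Ico, Finset.card_range, nsmul_eq_mul] at this
  rw [show 2 * R - R = R by omega] at this
  have hR0' : (0 : ℝ) < R := by exact_mod_cast hR0
  push_cast at this
  have h2 : (R : ℝ) * ((r : ℝ) / 2 ^ (d + 4) * (M * μ.real E)) ≤
      R * ∑ n ∈ Finset.Icc 1 (r * M), μ.real (B n) := by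
    have : (r : ℝ) / 2 ^ (d + 4) = (r : ℝ) / 2 ^ (d + 3) / 2 := by
      rw [pow_succ _ (d + 3)]; field_simp
    rw [this]
    linarith
  exact le_of_mul_le_mul_left h2 hR0'

/-! ### Shifted Borel–Cantelli lemma for ergodic maps. -/

/-- Mean mixing along some iterate, a consequence of the von Neumann ergodic theorem. -/
lemma Ergodic.exists_half_le_integral_preimage {X : Type*} [MeasurableSpace X] {μ : Measure X}
    [IsProbabilityMeasure μ] {T : X → X} (hT : Ergodic T μ) {φ : X → ℝ} (hφ : MemLp φ 2 μ)
    (hφ0 : 0 ≤ φ) {E : Set X} (hE : MeasurableSet E) :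
    ∃ v : ℕ, (∫ x, φ x ∂μ) * μ.real E / 2 ≤ ∫ x in T^[v] ⁻¹' E, φ x ∂μ := by
  have hmp := hT.toMeasurePreserving
  have hI0 : 0 ≤ ∫ x, φ x ∂μ := integral_nonneg hφ0
  rcases hI0.eq_or_lt with h0 | hI
  · refine ⟨0, ?_⟩
    rw [← h0, zero_mul, zero_div]
    exact integral_nonneg hφ0
  rcases (measureReal_nonneg (μ := μ) (s := E)).eq_or_lt with h0 | hEpos
  · refine ⟨0, ?_⟩
    rw [← h0, mul_zero, zero_div]
    exact integral_nonneg hφ0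
  let U : Lp ℝ 2 μ →L[ℝ] Lp ℝ 2 μ :=
    (Lp.compMeasurePreservingₗᵢ ℝ T hmp).toContinuousLinearMap
  have hU : ‖U‖ ≤ 1 := LinearIsometry.norm_toContinuousLinearMap_le _
  have hindL : ∀ n, MemLp ((T^[n] ⁻¹' E).indicator (fun _ => (1 : ℝ))) 2 μ := fun n =>
    (memLp_const _).indicator ((hmp.iterate n).measurable hE)
  let e : Lp ℝ 2 μ := (hindL 0).toLp _
  have hUe : ∀ n, U^[n] e = (hindL n).toLp _ := by
    intro n
    have h1 : (U : Lp ℝ 2 μ → Lp ℝ 2 μ) = Lp.compMeasurePreserving T hmp := rfl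
    have h2 := Lp.compMeasurePreserving_iterate (E := ℝ) (p := 2) hmp n
    rw [h1, h2]
    exact Lp.toLp_compMeasurePreserving _ _
  -- By ergodicity the limit is the constant `μ.real E`. The integrals over the preimages thus
  -- average to `(∫ φ) * μ.real E`, and cannot all stay below half of it.
  have hlim := U.tendsto_birkhoffAverage_orthogonalProjection hU e
  set S := (U.eqLocus (1 : Lp ℝ 2 μ →L[ℝ] Lp ℝ 2 μ))
  set P : Lp ℝ 2 μ := ((S.orthogonalProjectionOnto e : S) : Lp ℝ 2 μ) with hP
  have hPinv : U P = P := (S.orthogonalProjectionOnto e).2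
  obtain ⟨c, hc⟩ : ∃ c : ℝ, P =ᵐ[μ] Function.const X c := by
    refine hT.ae_eq_const_of_ae_eq_comp_ae (Lp.aestronglyMeasurable P) ?_
    have h1 := Lp.coeFn_compMeasurePreserving P hmp
    have h2 : Lp.compMeasurePreserving T hmp P = P := hPinv
    rw [h2] at h1
    exact h1.symm
  let one : Lp ℝ 2 μ := (memLp_const (1 : ℝ)).toLp _
  have hone : one ∈ S := by
    change U one = one
    exact Lp.toLp_compMeasurePreserving (memLp_const (1 : ℝ)) hmp
  have hinner : ∀ (f g : Lp ℝ 2 μ) (f' g' : X → ℝ), f =ᵐ[μ] f' → g =ᵐ[μ] g' →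
      inner ℝ f g = ∫ x, f' x * g' x ∂μ := by
    intro f g f' g' hf hg
    rw [L2.inner_def]
    refine integral_congr_ae ?_
    filter_upwards [hf, hg] with x h1 h2
    rw [h1, h2]
    simp [mul_comm]
  have hcE : c = μ.real E := by
    have h1 : inner ℝ one P = inner ℝ one e := by
      have := S.inner_orthogonalProjectionOnto_eq_of_mem_left ⟨one, hone⟩ e
      exact this
    rw [hinner one P _ _ (MemLp.coeFn_toLp _) hc,
      hinner one e _ _ (MemLp.coeFn_toLp _) (MemLp.coeFn_toLp _)] at h1
    simpa [integral_indicator_const _ hE] using h1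
  let ψ : Lp ℝ 2 μ := hφ.toLp φ
  have hψP : inner ℝ ψ P = (∫ x, φ x ∂μ) * μ.real E := by
    rw [hinner ψ P _ _ (MemLp.coeFn_toLp _) hc, ← hcE]
    exact integral_mul_const c φ
  have hψU : ∀ n, inner ℝ ψ (U^[n] e) = ∫ x in T^[n] ⁻¹' E, φ x ∂μ := by
    intro n
    rw [hUe, hinner ψ _ _ _ (MemLp.coeFn_toLp _) (MemLp.coeFn_toLp _),
      ← integral_indicator ((hmp.iterate n).measurable hE)]
    refine integral_congr_ae (ae_of_all _ fun x => ?_)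
    simp only [Set.indicator]
    split_ifs <;> simp
  have hlim2 := (continuous_const.inner continuous_id : Continuous fun y => inner ℝ ψ y).tendsto P
    |>.comp hlim
  by_contra! hcon
  have hle : inner ℝ ψ P ≤ (∫ x, φ x ∂μ) * μ.real E / 2 := by
    refine le_of_tendsto hlim2 ?_
    filter_upwards [eventually_gt_atTop 0] with N hN
    have hN' : (0 : ℝ) < N := by exact_mod_cast hN
    simp only [Function.comp, id, birkhoffAverage, birkhoffSum, inner_smul_right, inner_sum, hψU]
    rw [inv_mul_le_iff₀ hN']
    refine (Finset.sum_le_card_nsmul _ _ _ fun n _ => (hcon n).le).trans ?_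
    simp
  rw [hψP] at hle
  have := mul_pos hI hEpos
  linarith

/-- In a probability preserving ergodic system, any sequence of events with divergent sum of
measures can be shifted along the orbits so that almost every point is in infinitely many of
them. -/
lemma Ergodic.exists_frequently_mem {X : Type*} [MeasurableSpace X] {μ : Measure X}
    [IsProbabilityMeasure μ] {T : X → X} (hT : Ergodic T μ) {G : ℕ → Set X}
    (hG : ∀ n, MeasurableSet (G n)) (hsum : ¬ Summable fun n => μ.real (G n)) :
    ∃ v : ℕ → ℕ, ∀ᵐ x ∂μ, ∃ᶠ n in atTop, T^[v n] x ∈ G n := by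
  classical
  -- A shift is chosen for every `φ`, admissible or not, so that the recursion below need not carry
  -- proofs.
  have hstep : ∀ (n : ℕ) (φ : X → ℝ), ∃ v : ℕ, Measurable φ → 0 ≤ φ → φ ≤ 1 →
      (∫ x, φ x ∂μ) * μ.real (G n) / 2 ≤ ∫ x in T^[v] ⁻¹' G n, φ x ∂μ := by
    intro n φ
    by_cases h : Measurable φ ∧ 0 ≤ φ ∧ φ ≤ 1
    · obtain ⟨v, hv⟩ := hT.exists_half_le_integral_preimage (φ := φ)
        (MemLp.of_bound h.1.aestronglyMeasurable 1 (ae_of_all _ fun x => by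
          rw [Real.norm_of_nonneg (h.2.1 x)]; exact h.2.2 x)) h.2.1 (hG n)
      exact ⟨v, fun _ _ _ => hv⟩
    · exact ⟨0, fun h1 h2 h3 => absurd ⟨h1, h2, h3⟩ h⟩
  choose w hw using hstep
  -- the potential is halved at each visit
  let Φ : ℕ → X → ℝ := fun n => Nat.rec (fun _ => 1)
    (fun n φ x => if T^[w n φ] x ∈ G n then φ x / 2 else φ x) n
  let v : ℕ → ℕ := fun n => w n (Φ n)
  have hsucc : ∀ n x, Φ (n + 1) x = if T^[v n] x ∈ G n then Φ n x / 2 else Φ n x :=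
    fun n x => rfl
  have hpre : ∀ n, MeasurableSet (T^[v n] ⁻¹' G n) := fun n =>
    (hT.toMeasurePreserving.iterate _).measurable (hG n)
  have hΦ : ∀ n, Measurable (Φ n) ∧ (∀ x, (1 / 2 : ℝ) ^ n ≤ Φ n x) ∧ ∀ x, Φ n x ≤ 1 := by
    intro n
    induction n with
    | zero => exact ⟨measurable_const, fun x => by simp [Φ], fun x => le_rfl⟩
    | succ n ih =>
      obtain ⟨h1, h2, h3⟩ := ih
      refine ⟨Measurable.ite (hpre n) (h1.div_const 2) h1, fun x => ?_, fun x => ?_⟩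
      · have := h2 x
        have h0 : (0 : ℝ) < (1 / 2) ^ n := by positivity
        rw [hsucc, pow_succ]
        split_ifs <;> linarith
      · have := h2 x
        have := h3 x
        have h0 : (0 : ℝ) < (1 / 2) ^ n := by positivity
        rw [hsucc]
        split_ifs <;> linarith
  have hΦ0 : ∀ n x, 0 ≤ Φ n x := fun n x => le_trans (by positivity) ((hΦ n).2.1 x)
  have hΦint : ∀ n, Integrable (Φ n) μ := fun n =>
    Integrable.of_bound (hΦ n).1.aestronglyMeasurable 1 (ae_of_all _ fun x => by
      rw [Real.norm_of_nonneg (hΦ0 n x)]; exact (hΦ n).2.2 x)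
  have hI : ∀ n, ∫ x, Φ n x ∂μ ≤ Real.exp (-(1 / 4) * ∑ i ∈ Finset.range n, μ.real (G i)) := by
    intro n
    induction n with
    | zero => simp [Φ]
    | succ n ih =>
      have h1 : ∫ x, Φ (n + 1) x ∂μ =
          ∫ x, Φ n x ∂μ - (∫ x in T^[v n] ⁻¹' G n, Φ n x ∂μ) / 2 := by
        rw [← integral_indicator (hpre n), ← integral_div,
          ← integral_sub (hΦint n) (((hΦint n).indicator (hpre n)).div_const 2)]
        refine integral_congr_ae (ae_of_all _ fun x => ?_)
        simp only [hsucc, Set.indicator, Set.mem_preimage]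
        split_ifs <;> ring
      have h2 := hw n (Φ n) (hΦ n).1 (hΦ0 n) (hΦ n).2.2
      have h3 : 1 - μ.real (G n) / 4 ≤ Real.exp (-(1 / 4) * μ.real (G n)) := by
        have := Real.add_one_le_exp (-(1 / 4) * μ.real (G n))
        linarith
      rw [Finset.sum_range_succ, mul_add, Real.exp_add]
      calc ∫ x, Φ (n + 1) x ∂μ ≤ (∫ x, Φ n x ∂μ) * (1 - μ.real (G n) / 4) := by
            rw [h1]; change _ ≤ ∫ x in T^[v n] ⁻¹' G n, Φ n x ∂μ at h2; linarith
        _ ≤ (∫ x, Φ n x ∂μ) * Real.exp (-(1 / 4) * μ.real (G n)) := by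
            gcongr
            exact integral_nonneg (hΦ0 n)
        _ ≤ _ := by gcongr
  have hlim : Tendsto (fun n => ∫ x, Φ n x ∂μ) atTop (𝓝 0) := by
    refine squeeze_zero (fun n => integral_nonneg (hΦ0 n)) hI ?_
    refine Real.tendsto_exp_atBot.comp ?_
    refine Tendsto.const_mul_atTop_of_neg (by norm_num) ?_
    exact (not_summable_iff_tendsto_nat_atTop_of_nonneg fun n => measureReal_nonneg).1 hsum
  refine ⟨v, ?_⟩
  -- A point with no visit after time `N` keeps potential at least `2 ^ (-N)`, while the integrals
  -- tend to 0.
  have hnull : ∀ N, μ {x | ∀ n ≥ N, T^[v n] x ∉ G n} = 0 := by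
    intro N
    set W := {x | ∀ n ≥ N, T^[v n] x ∉ G n} with hW
    have hWm : MeasurableSet W := by
      have : W = ⋂ n, ⋂ (_ : n ≥ N), (T^[v n] ⁻¹' G n)ᶜ := by ext x; simp [hW]
      rw [this]
      exact MeasurableSet.iInter fun n => MeasurableSet.iInter fun _ => (hpre n).compl
    have hconst : ∀ x ∈ W, ∀ n ≥ N, Φ n x = Φ N x := by
      intro x hx n hn
      induction n, hn using Nat.le_induction with
      | base => rfl
      | succ n hn ih => rw [hsucc, if_neg (hx n hn), ih]
    have hle : ∀ n ≥ N, (1 / 2 : ℝ) ^ N * μ.real W ≤ ∫ x, Φ n x ∂μ := fun n hn => calc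
      (1 / 2 : ℝ) ^ N * μ.real W ≤ ∫ x in W, Φ n x ∂μ :=
        setIntegral_ge_of_const_le_real hWm (measure_ne_top _ _)
          (fun x hx => by rw [hconst x hx n hn]; exact (hΦ N).2.1 x) (hΦint n).integrableOn
      _ ≤ ∫ x, Φ n x ∂μ := setIntegral_le_integral (hΦint n) (ae_of_all _ (hΦ0 n))
    have h0 : (1 / 2 : ℝ) ^ N * μ.real W ≤ 0 := ge_of_tendsto hlim (by
      filter_upwards [eventually_ge_atTop N] with n hn using hle n hn)
    have h1 : μ.real W ≤ 0 := by
      by_contra! hpos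
      have : 0 < (1 / 2 : ℝ) ^ N * μ.real W := by positivity
      linarith
    have h2 : μ.real W = 0 := le_antisymm h1 measureReal_nonneg
    rwa [measureReal_eq_zero_iff] at h2
  have : ∀ᵐ x ∂μ, ∀ N, ¬ ∀ n ≥ N, T^[v n] x ∉ G n :=
    ae_all_iff.2 fun N => by simpa [ae_iff] using hnull N
  filter_upwards [this] with x hx
  rw [frequently_atTop]
  intro N
  have := hx N
  push Not at this
  exact this

/-! ### Construction of the peaks. -/

/-- A measure on a standard Borel space without point masses has sets of arbitrarily small
positive measure. -/
lemma exists_measurableSet_measureReal_lt {X : Type*} [MeasurableSpace X] [StandardBorelSpace X]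
    (μ : Measure X) [IsProbabilityMeasure μ] [NullSingletonClass μ] {δ : ℝ} (hδ : 0 < δ) :
    ∃ E : Set X, MeasurableSet E ∧ 0 < μ.real E ∧ μ.real E < δ := by
  let := upgradeStandardBorel X
  obtain ⟨x, -, hx⟩ := exists_mem_forall_mem_nhdsWithin_pos_measure
    (μ := μ) (s := Set.univ) (by simp)
  obtain ⟨U, hxU, hU, hμU⟩ := Set.exists_isOpen_lt_of_lt (μ := μ) {x} (ENNReal.ofReal δ)
    (by simpa using hδ)
  refine ⟨U, hU.measurableSet, ?_, ?_⟩
  · refine ENNReal.toReal_pos (hx U ?_).ne' (measure_ne_top _ _)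
    rw [nhdsWithin_univ]
    exact hU.mem_nhds (hxU rfl)
  · rw [measureReal_def]
    exact (ENNReal.lt_ofReal_iff_toReal_lt (measure_ne_top _ _)).1 hμU

/-- An integrable function which dominates very high and not too narrow peaks. -/
lemma exists_integrable_ge_peaks {X : Type*} [MeasurableSpace X] [StandardBorelSpace X]
    (μ : Measure X) [IsProbabilityMeasure μ] [NullSingletonClass μ] :
    ∃ g : X → ℝ, Measurable g ∧ 0 ≤ g ∧ Integrable g μ ∧ ∫ x, g x ∂μ ≤ 1 / 4 ∧
      ∃ (E : ℕ → Set X) (M : ℕ → ℕ), ∀ k, MeasurableSet (E k) ∧ 2 * (4 ^ k) ^ k ≤ M k ∧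
        (1 / 2 : ℝ) ^ (k + 4) ≤ M k * μ.real (E k) ∧
        ∀ᵐ x ∂μ, (E k).indicator (fun _ => (M k : ℝ)) x ≤ g x := by
  have hpeak : ∀ k : ℕ, ∃ (E : Set X) (M : ℕ), MeasurableSet E ∧ 2 * (4 ^ k) ^ k ≤ M ∧
      (1 / 2 : ℝ) ^ (k + 4) ≤ M * μ.real E ∧ M * μ.real E ≤ (1 / 2 : ℝ) ^ (k + 3) := by
    intro k
    obtain ⟨E, hE, hE0, hEδ⟩ := exists_measurableSet_measureReal_lt μ
      (δ := (1 / 2 : ℝ) ^ (k + 3) / ((2 * (4 ^ k) ^ k : ℕ) : ℝ)) (by positivity)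
    rw [lt_div_iff₀ (by positivity)] at hEδ
    -- This height would give mass exactly `2 ^ (-(k + 3))`; rounding down loses at most a factor 2.
    set q := (1 / 2 : ℝ) ^ (k + 3) / μ.real E with hq
    have hqM : ((2 * (4 ^ k) ^ k : ℕ) : ℝ) ≤ q := by
      rw [hq, le_div_iff₀ hE0, mul_comm]
      exact hEδ.le
    have hqE : q * μ.real E = (1 / 2 : ℝ) ^ (k + 3) := div_mul_cancel₀ _ hE0.ne'
    have hM : 2 * (4 ^ k) ^ k ≤ ⌊q⌋₊ := Nat.le_floor hqM
    have hM1 : (1 : ℝ) ≤ ⌊q⌋₊ := by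
      have : 1 ≤ ⌊q⌋₊ := le_trans (by have : 0 < (4 ^ k) ^ k := by positivity
                                      omega) hM
      exact_mod_cast this
    refine ⟨E, ⌊q⌋₊, hE, hM, ?_, ?_⟩
    · have h1 : q ≤ 2 * ⌊q⌋₊ := by have := Nat.lt_floor_add_one q; linarith
      have h2 := mul_le_mul_of_nonneg_right h1 hE0.le
      rw [pow_succ, ← hqE]
      linarith
    · rw [← hqE]
      exact mul_le_mul_of_nonneg_right (Nat.floor_le (by positivity)) hE0.le
  choose E M hE hM hlow hup using hpeak
  set h : ℕ → X → ENNReal := fun k => (E k).indicator fun _ => (M k : ENNReal) with hh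
  have hhm : ∀ k, Measurable (h k) := fun k => measurable_const.indicator (hE k)
  have hlint : ∫⁻ x, ∑' k, h k x ∂μ ≤ ENNReal.ofReal (1 / 4) := by
    rw [lintegral_tsum fun k => (hhm k).aemeasurable]
    have hs : HasSum (fun k : ℕ => (1 / 2 : ℝ) ^ (k + 3)) (1 / 4) := by
      have := (hasSum_geometric_two).mul_right ((1 / 2 : ℝ) ^ 3)
      simp only [← pow_add] at this
      norm_num at this ⊢
      exact this
    rw [← hs.tsum_eq, ENNReal.ofReal_tsum_of_nonneg (fun k => by positivity) hs.summable]
    refine ENNReal.tsum_le_tsum fun k => ?_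
    rw [hh, lintegral_indicator_const (hE k), ENNReal.le_ofReal_iff_toReal_le
      (ENNReal.mul_ne_top (ENNReal.natCast_ne_top _) (measure_ne_top _ _)) (by positivity)]
    simpa [measureReal_def] using hup k
  have hm : Measurable fun x => ∑' k, h k x := Measurable.tsum hhm
  have hne : ∫⁻ x, ∑' k, h k x ∂μ ≠ ⊤ := (hlint.trans_lt ENNReal.ofReal_lt_top).ne
  refine ⟨fun x => (∑' k, h k x).toReal, hm.ennreal_toReal, fun x => ENNReal.toReal_nonneg,
    integrable_toReal_of_lintegral_ne_top hm.aemeasurable hne, ?_, E, M,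
    fun k => ⟨hE k, hM k, hlow k, ?_⟩⟩
  · rw [integral_toReal hm.aemeasurable (ae_lt_top hm hne)]
    exact ENNReal.toReal_le_of_le_ofReal (by norm_num) hlint
  -- Where the series is infinite `toReal` returns 0, so domination holds only almost everywhere.
  · filter_upwards [ae_lt_top hm hne] with x hx
    have h1 : (h k x).toReal ≤ (∑' k, h k x).toReal :=
      ENNReal.toReal_mono hx.ne (ENNReal.le_tsum k)
    refine le_trans (le_of_eq ?_) h1
    simp only [hh, Set.indicator]
    split_ifs <;> simp

/-- There is an integrable function of small integral whose ergodic averages along the `d`-th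
powers are large on sets with divergent sum of measures, whatever the measure preserving map. -/
lemma exists_not_summable_measure_averages {X : Type*} [MeasurableSpace X] [StandardBorelSpace X]
    (μ : Measure X) [IsProbabilityMeasure μ] [NullSingletonClass μ] :
    ∃ g : X → ℝ, Measurable g ∧ 0 ≤ g ∧ Integrable g μ ∧ ∫ x, g x ∂μ ≤ 1 / 4 ∧
      ∀ T : X → X, MeasurePreserving T μ μ → ∀ d : ℕ, 1 ≤ d → ¬ Summable fun n : ℕ =>
        μ.real {x | ((n ^ d : ℕ) : ℝ) / 2 ≤ ∑ i ∈ Finset.range (n ^ d), g (T^[i] x)} := by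
  obtain ⟨g, hgm, hg0, hgi, hg4, E, M, hEM⟩ := exists_integrable_ge_peaks μ
  refine ⟨g, hgm, hg0, hgi, hg4, fun T hT d hd hsum => ?_⟩
  have hbound : ∀ j : ℕ, (2 : ℝ) ^ j ≤ ∑' n : ℕ,
      μ.real {x | ((n ^ d : ℕ) : ℝ) / 2 ≤ ∑ i ∈ Finset.range (n ^ d), g (T^[i] x)} := by
    intro j
    -- The bound `4 ^ k / 2 ^ (d + 4) * 2 ^ (-(k + 4))` then equals `2 ^ j`; also `d ≤ k`, so the
    -- peak is high enough for `r = 4 ^ k`.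
    set k := d + j + 8 with hk
    obtain ⟨hE, hM, hlow, hdom⟩ := hEM k
    have h1 := le_sum_measure_windows hT hE (M := M k) (r := 4 ^ k) (d := d)
      (Nat.one_le_pow _ _ (by norm_num)) hd (le_trans (Nat.mul_le_mul_left 2
        (Nat.pow_le_pow_right (by positivity) (by omega))) hM)
    have h2 : (2 : ℝ) ^ j ≤ ((4 ^ k : ℕ) : ℝ) / 2 ^ (d + 4) * (M k * μ.real (E k)) := calc
      (2 : ℝ) ^ j = ((4 ^ k : ℕ) : ℝ) / 2 ^ (d + 4) * (1 / 2 : ℝ) ^ (k + 4) := by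
        push_cast
        rw [one_div, inv_pow, show (4 : ℝ) = 2 ^ 2 by norm_num, ← pow_mul]
        field_simp
        rw [← pow_add, ← pow_add]
        congr 1
        omega
      _ ≤ _ := by gcongr
    refine h2.trans (h1.trans ?_)
    refine le_trans (Finset.sum_le_sum fun n _ => ?_)
      (hsum.sum_le_tsum (Finset.Icc 1 (4 ^ k * M k)) fun n _ => measureReal_nonneg)
    refine ENNReal.toReal_mono (measure_ne_top _ _) (measure_mono_ae ?_)
    have hall : ∀ᵐ x ∂μ, ∀ i : ℕ,
        (E k).indicator (fun _ => (M k : ℝ)) (T^[i] x) ≤ g (T^[i] x) :=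
      ae_all_iff.2 fun i => (hT.iterate i).quasiMeasurePreserving.ae hdom
    filter_upwards [hall] with x hx hxB
    exact le_trans hxB (Finset.sum_le_sum fun i _ => hx i)
  obtain ⟨j, hj⟩ := pow_unbounded_of_one_lt (∑' n : ℕ,
      μ.real {x | ((n ^ d : ℕ) : ℝ) / 2 ≤ ∑ i ∈ Finset.range (n ^ d), g (T^[i] x)})
      (one_lt_two : (1 : ℝ) < 2)
  exact (hbound j).not_gt hj

/-! ### Choice of the shifts and conclusion. -/

/-- The moving average starting right after `v - 1` in terms of iterates. -/
lemma movingAverage_natCast_sub_one {X : Type*} [MeasurableSpace X] (T : X ≃ᵐ X) (f : X → ℝ)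
    (v L : ℕ) (x : X) :
    movingAverage T f ((v : ℤ) - 1) L x =
      (1 / (L : ℝ)) * ∑ i ∈ Finset.range L, f (T^[i] (T^[v] x)) := by
  rw [movingAverage]
  congr 1
  symm
  refine Finset.sum_bij (fun i _ => ((i + v : ℕ) : ℤ)) ?_ ?_ ?_ ?_
  · intro i hi
    rw [Finset.mem_range] at hi
    rw [Finset.mem_Icc]
    omega
  · intro i _ j _ h
    omega
  · intro b hb
    rw [Finset.mem_Icc] at hb
    exact ⟨(b - v).toNat, by rw [Finset.mem_range]; omega, by omega⟩
  · intro i _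
    rw [zpow_natCast, ← Equiv.Perm.iterate_eq_pow, ← Function.iterate_add_apply]
    rfl

/-- If a nonnegative series diverges, it diverges along the even or the odd integers. -/
lemma exists_not_summable_indicator_parity {b : ℕ → ℝ} (hb : ¬ Summable b) :
    ∃ ε : ℕ, ¬ Summable ({n : ℕ | n % 2 = ε}.indicator b) ∧
      {n : ℕ | n % 2 = ε}ᶜ.Infinite := by
  have hinf : ∀ ε : ℕ, {n : ℕ | n % 2 = ε}ᶜ.Infinite := by
    intro ε
    refine Set.infinite_of_forall_exists_gt fun a => ?_
    by_cases h : (a + 1) % 2 = ε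
    · exact ⟨a + 2, by simp only [Set.mem_compl_iff, Set.mem_ofPred_eq]; omega, by omega⟩
    · exact ⟨a + 1, h, by omega⟩
  by_contra! hcon
  have h0 : Summable ({n : ℕ | n % 2 = 0}.indicator b) := by
    by_contra h
    exact hinf 0 (hcon 0 h)
  have h1 : Summable ({n : ℕ | n % 2 = 1}.indicator b) := by
    by_contra h
    exact hinf 1 (hcon 1 h)
  refine hb ((h0.add h1).congr fun n => ?_)
  simp only [Set.indicator, Set.mem_ofPred_eq]
  rcases Nat.mod_two_eq_zero_or_one n with h | h <;> simp [h]

theorem mainTheorem3 {X : Type*} [MeasurableSpace X] [StandardBorelSpace X]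
    (μ : Measure X) [IsProbabilityMeasure μ] [NullSingletonClass μ] :
    ∃ f : X → ℝ, Integrable f μ ∧ ∫ x, f x ∂μ = 0 ∧
      ∀ T : X ≃ᵐ X, Ergodic T μ →
        ∀ d : ℕ, 1 ≤ d →
          ∃ v : ℕ → ℤ, ∀ᵐ x ∂μ,
            0 < limsup (fun n : ℕ => ((movingAverage T f (v n) (n ^ d) x : ℝ) : EReal)) atTop ∧
            ¬ ∃ l : ℝ, Tendsto (fun n : ℕ => movingAverage T f (v n) (n ^ d) x) atTop (𝓝 l) := by
  classical
  obtain ⟨g, hgm, hg0, hgi, hg4, hdiv⟩ := exists_not_summable_measure_averages μ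
  set c := ∫ x, g x ∂μ with hc
  have hc0 : 0 ≤ c := integral_nonneg hg0
  refine ⟨fun x => g x - c, hgi.sub (integrable_const c), ?_, fun T hT d hd => ?_⟩
  · rw [integral_sub hgi (integrable_const c)]
    simp [hc]
  have hmp := hT.toMeasurePreserving
  set S : ℕ → X → ℝ := fun n x => ∑ i ∈ Finset.range (n ^ d), g (T^[i] x) with hS
  have hSm : ∀ n, Measurable (S n) := fun n =>
    Finset.measurable_sum _ fun i _ => hgm.comp (hmp.iterate i).measurable
  have hgT : ∀ i, Integrable (fun x => g (T^[i] x)) μ := fun i =>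
    (hmp.iterate i).integrable_comp_of_integrable hgi
  set B : ℕ → Set X := fun n => {x | ((n ^ d : ℕ) : ℝ) / 2 ≤ S n x} with hB
  set D : ℕ → Set X := fun n => {x | S n x < ((n ^ d : ℕ) : ℝ) * (c + 1 / 8)} with hD
  have hBm : ∀ n, MeasurableSet (B n) := fun n => measurableSet_le measurable_const (hSm n)
  have hDm : ∀ n, MeasurableSet (D n) := fun n => measurableSet_lt (hSm n) measurable_const
  -- Markov bounds the complement by `c / (c + 1 / 8)`, at most 2/3 since `c ≤ 1 / 4`.
  have hDμ : ∀ n, 1 ≤ n → 1 / 3 ≤ μ.real (D n) := by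
    intro n hn
    have hLpos : (0 : ℝ) < ((n ^ d : ℕ) : ℝ) := by
      exact_mod_cast Nat.pow_pos (n := d) hn
    have hSint : ∫ x, S n x ∂μ = ((n ^ d : ℕ) : ℝ) * c := by
      have hgTint : ∀ i, ∫ x, g (T^[i] x) ∂μ = c := fun i => by
        rw [← integral_map (hmp.iterate i).measurable.aemeasurable
          hgm.aestronglyMeasurable, (hmp.iterate i).map_eq]
      change ∫ x, ∑ i ∈ Finset.range (n ^ d), g (T^[i] x) ∂μ = _
      rw [integral_finsetSum _ fun i _ => hgT i]
      simp only [hgTint, Finset.sum_const, Finset.card_range, nsmul_eq_mul]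
    have hmk := mul_meas_ge_le_integral_of_nonneg (μ := μ) (f := S n)
      (ae_of_all _ fun x => Finset.sum_nonneg fun i _ => hg0 _)
      (integrable_finsetSum _ fun i _ => hgT i)
      (((n ^ d : ℕ) : ℝ) * (c + 1 / 8))
    rw [hSint, mul_assoc] at hmk
    have hmk2 := le_of_mul_le_mul_left hmk hLpos
    have hcompl : {x | ((n ^ d : ℕ) : ℝ) * (c + 1 / 8) ≤ S n x} = (D n)ᶜ := by
      ext x; simp [hD]
    rw [hcompl, probReal_compl_eq_one_sub (hDm n)] at hmk2
    nlinarith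
  obtain ⟨ε, hε, hinf⟩ := exists_not_summable_indicator_parity (hdiv T hmp d hd)
  set P : Set ℕ := {n | n % 2 = ε} with hP
  obtain ⟨v₁, hv₁⟩ := hT.exists_frequently_mem (G := fun n => if n ∈ P then B n else ∅)
    (fun n => by split_ifs; exacts [hBm n, MeasurableSet.empty]) (by
      refine fun h => hε (h.congr fun n => ?_)
      by_cases hn : n ∈ P <;> simp [hn, hB, hS])
  obtain ⟨v₂, hv₂⟩ := hT.exists_frequently_mem (G := fun n => if n ∈ P then ∅ else D n)
    (fun n => by split_ifs; exacts [MeasurableSet.empty, hDm n]) (by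
      intro h
      have h1 := h.tendsto_atTop_zero.eventually (gt_mem_nhds (by norm_num : (0 : ℝ) < 1 / 3))
      have h2 : ∃ᶠ n in atTop, n ∈ Pᶜ := Nat.frequently_atTop_iff_infinite.2 hinf
      obtain ⟨n, hnP, hn, hn1⟩ := (h2.and_eventually (h1.and (eventually_ge_atTop 1))).exists
      rw [if_neg hnP] at hn
      exact (hDμ n hn1).not_gt hn)
  -- The shift by `-1` compensates for the moving average starting at `v + 1`.
  refine ⟨fun n => ((if n ∈ P then v₁ n else v₂ n : ℕ) : ℤ) - 1, ?_⟩
  filter_upwards [hv₁, hv₂] with x hx₁ hx₂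
  simp only [movingAverage_natCast_sub_one]
  have havg : ∀ n : ℕ, 1 ≤ n → ∀ y, (1 / ((n ^ d : ℕ) : ℝ)) *
      ∑ i ∈ Finset.range (n ^ d), (g (T^[i] y) - c) = S n y / ((n ^ d : ℕ) : ℝ) - c := by
    intro n hn y
    have hLpos : (0 : ℝ) < ((n ^ d : ℕ) : ℝ) := by
      exact_mod_cast Nat.pow_pos (n := d) hn
    rw [Finset.sum_sub_distrib, Finset.sum_const, Finset.card_range, nsmul_eq_mul]
    field_simp
    rfl
  set A : ℕ → ℝ := fun n => (1 / ((n ^ d : ℕ) : ℝ)) * ∑ i ∈ Finset.range (n ^ d),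
    (g (T^[i] (T^[if n ∈ P then v₁ n else v₂ n] x)) - c) with hA
  have hhigh : ∃ᶠ n in atTop, 1 / 4 ≤ A n := by
    refine (hx₁.and_eventually (eventually_ge_atTop 1)).mono fun n hn => ?_
    obtain ⟨h1, hn⟩ := hn
    have hLpos : (0 : ℝ) < ((n ^ d : ℕ) : ℝ) := by
      exact_mod_cast Nat.pow_pos (n := d) hn
    by_cases hnP : n ∈ P
    · rw [if_pos hnP] at h1
      have h2 : 1 / 2 ≤ S n (T^[v₁ n] x) / ((n ^ d : ℕ) : ℝ) := by
        rw [le_div_iff₀ hLpos]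
        have h3 : ((n ^ d : ℕ) : ℝ) / 2 ≤ S n (T^[v₁ n] x) := h1
        linarith
      rw [hA]
      simp only [if_pos hnP]
      rw [havg n hn]
      linarith
    · rw [if_neg hnP] at h1
      exact h1.elim
  have hlow : ∃ᶠ n in atTop, A n ≤ 1 / 8 := by
    refine (hx₂.and_eventually (eventually_ge_atTop 1)).mono fun n hn => ?_
    obtain ⟨h1, hn⟩ := hn
    have hLpos : (0 : ℝ) < ((n ^ d : ℕ) : ℝ) := by
      exact_mod_cast Nat.pow_pos (n := d) hn
    by_cases hnP : n ∈ P
    · rw [if_pos hnP] at h1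
      exact h1.elim
    · rw [if_neg hnP] at h1
      have h2 : S n (T^[v₂ n] x) / ((n ^ d : ℕ) : ℝ) ≤ c + 1 / 8 := by
        rw [div_le_iff₀ hLpos]
        have h3 : S n (T^[v₂ n] x) < ((n ^ d : ℕ) : ℝ) * (c + 1 / 8) := h1
        linarith
      rw [hA]
      simp only [if_neg hnP]
      rw [havg n hn]
      linarith
  constructor
  · have h1 : (((1 / 4 : ℝ)) : EReal) ≤ limsup (fun n => (A n : EReal)) atTop :=
      le_limsup_of_frequently_le (hhigh.mono fun n hn => EReal.coe_le_coe_iff.2 hn)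
    exact lt_of_lt_of_le (EReal.coe_pos.2 (by norm_num)) h1
  · rintro ⟨l, hl⟩
    have h1 : 1 / 4 ≤ l := ge_of_tendsto_of_frequently hl hhigh
    have h2 : l ≤ 1 / 8 := le_of_tendsto_of_frequently hl hlow
    linarith
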